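/- Let $c \ge 2$ be an integer. Let $\mathrm{GL} = \mathrm{GL}_2(\mathbb{C}) \times \mathrm{GL}_{c-1}(\mathbb{C}) \times \mathrm{GL}_c(\mathbb{C})$ and $\mathrm{SL} = \mathrm{SL}_2(\mathbb{C}) \times \mathrm{SL}_{c-1}(\mathbb{C}) \times \mathrm{SL}_c(\mathbb{C})$ act on $V = \mathbb{C}^2 \otimes \mathbb{C}^{c-1} \otimes \mathbb{C}^c$ by $(A,B,C) \cdot T = (A \otimes B \otimes C)\,T$. All closures are taken in the Euclidean topology. A tensor $T \in V$ is called $\mathrm{SL}$-semistable if $0 \notin \overline{\mathrm{SL} \cdot T}$. Let $$\mathsf{P}_c = \mathsf{P}_{2,c-1} = \sum_{i=1}^{2} \sum_{j=1}^{c-1} e_i \otimes e_j \otimes e_{i+j-1} \in V$$ be the polynomial multiplication tensor, where the $e_i$ are standard basis vectors. Then: 1. the set of $\mathrm{SL}$-semistable tensors in $V$ equals the orbit $\mathrm{GL} \cdot \mathsf{P}_c$; 2. the orbit $\mathrm{GL} \cdot \mathsf{P}_c$ is dense in $V$, that is, $\overline{\mathrm{GL} \cdot \mathsf{P}_c} =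 V$; 3. the orbit $\mathrm{SL} \cdot \mathsf{P}_c$ is closed in $V$. -/

import Mathlib

/-- The tensor space `ℂ^a ⊗ ℂ^b ⊗ ℂ^c`: a tensor is given by its coordinates `T i j k` with respect to
the standard basis `e i ⊗ e j ⊗ e k` (indices start at `0`). The topology is the product topology,
which is the Euclidean topology of this finite-dimensional complex vector space. -/
abbrev Tensor3 (a b c : ℕ) : Type :=
  Fin a → Fin b → Fin c → ℂ

namespace Tensor3

/-- The elementary tensor `x ⊗ y ⊗ z`. -/
def tmul {a b c : ℕ} (x : Fin a → ℂ) (y : Fin b → ℂ) (z : Fin c → ℂ) : Tensor3 a b c :=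
  fun i j k => x i * y j * z k

/-- The action `(A ⊗ B ⊗ C) T` of a triple of square matrices on a tensor, in coordinates. -/
def act {a b c : ℕ} (A : Matrix (Fin a) (Fin a) ℂ) (B : Matrix (Fin b) (Fin b) ℂ)
    (C : Matrix (Fin c) (Fin c) ℂ) (T : Tensor3 a b c) : Tensor3 a b c :=
  fun i j k => ∑ i', ∑ j', ∑ k', A i i' * B j j' * C k k' * T i' j' k'

/-- On elementary tensors, the action is `x ⊗ y ⊗ z ↦ A x ⊗ B y ⊗ C z`. -/
theorem act_tmul {a b c : ℕ} (A : Matrix (Fin a) (Fin a) ℂ) (B : Matrix (Fin b) (Fin b) ℂ)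
    (C : Matrix (Fin c) (Fin c) ℂ) (x : Fin a → ℂ) (y : Fin b → ℂ) (z : Fin c → ℂ) :
    act A B C (tmul x y z) = tmul (A.mulVec x) (B.mulVec y) (C.mulVec z) := by
  funext i j k
  simp only [act, tmul, Matrix.mulVec, dotProduct]
  rw [mul_assoc, Finset.sum_mul]
  refine Finset.sum_congr rfl fun i' _ => ?_
  rw [Finset.sum_mul, Finset.mul_sum]
  refine Finset.sum_congr rfl fun j' _ => ?_
  rw [Finset.mul_sum, Finset.mul_sum]
  refine Finset.sum_congr rfl fun k' _ => ?_
  ring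

/-- The orbit of `T` under `GL = GL_a × GL_b × GL_c`. -/
def glOrbit {a b c : ℕ} (T : Tensor3 a b c) : Set (Tensor3 a b c) :=
  {S | ∃ (A : Matrix.GeneralLinearGroup (Fin a) ℂ) (B : Matrix.GeneralLinearGroup (Fin b) ℂ)
    (C : Matrix.GeneralLinearGroup (Fin c) ℂ), S = act A.val B.val C.val T}

/-- The orbit of `T` under `SL = SL_a × SL_b × SL_c`. -/
def slOrbit {a b c : ℕ} (T : Tensor3 a b c) : Set (Tensor3 a b c) :=
  {S | ∃ (A : Matrix.SpecialLinearGroup (Fin a) ℂ) (B : Matrix.SpecialLinearGroup (Fin b) ℂ)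
    (C : Matrix.SpecialLinearGroup (Fin c) ℂ), S = act A.val B.val C.val T}

/-- `T` is `SL`-unstable if the closure of its `SL`-orbit contains `0`. -/
def SLUnstable {a b c : ℕ} (T : Tensor3 a b c) : Prop :=
  (0 : Tensor3 a b c) ∈ closure (slOrbit T)

/-- `T` is `SL`-semistable if it is not `SL`-unstable. -/
def SLSemistable {a b c : ℕ} (T : Tensor3 a b c) : Prop :=
  ¬ SLUnstable T

/-- The polynomial multiplication tensor `P_{a,b} = ∑ i, ∑ j, e i ⊗ e j ⊗ e (i + j)` (indices start
at `0`) in `ℂ^a ⊗ ℂ^b ⊗ ℂ^c`, where `c = a + b - 1`. -/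
noncomputable def polyMul (a b c : ℕ) (h : a + b = c + 1) : Tensor3 a b c :=
  ∑ i : Fin a, ∑ j : Fin b,
    tmul (Pi.single i 1) (Pi.single j 1)
      (Pi.single ⟨i.val + j.val, by have := i.isLt; have := j.isLt; omega⟩ 1)

/-- The tensor `P_c = P_{2,c-1}` in `ℂ^2 ⊗ ℂ^(c-1) ⊗ ℂ^c`. -/
noncomputable def pencil (c : ℕ) (hc : 2 ≤ c) : Tensor3 2 (c - 1) c :=
  polyMul 2 (c - 1) c (by omega)

end Tensor3

/-! Put `c = n + 1` and view `T` as a pencil of `n × (n + 1)` matrices. Its signed maximal minors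
are `n + 1` binary forms of degree `n`, and the determinant of their coefficients is an
`SL`-invariant of degree `n (n + 1)`. `minorDet` is this invariant read off from values at `n + 1`
points (`minorDet_act`); it is nonzero at the multiplication tensor, and where it is nonzero the
tensor is semistable.

Conversely, as in Kronecker's theory of pencils, a shortest polynomial kernel vector of `T` yields
either subspaces that destabilise `T` or bases in which `T` is the multiplication tensor
(`slUnstable_or_mem_glOrbit_polyMul`). So the `GL`-orbit is both the semistable set and the
nonvanishing locus of the invariant, hence dense. The `SL`-orbit is a level set of the invariant,
because the remaining scalars are roots of unity that `SL` absorbs. -/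

namespace Tensor3

/-! ### The action and scalar factors -/

open Matrix in
theorem act_act {a b c : ℕ} (A A' : Matrix (Fin a) (Fin a) ℂ) (B B' : Matrix (Fin b) (Fin b) ℂ)
    (C C' : Matrix (Fin c) (Fin c) ℂ) (T : Tensor3 a b c) :
    act A B C (act A' B' C' T) = act (A * A') (B * B') (C * C') T := by
  have key : ∀ (A : Matrix (Fin a) (Fin a) ℂ) (B : Matrix (Fin b) (Fin b) ℂ)
      (C : Matrix (Fin c) (Fin c) ℂ) (T : Tensor3 a b c) (x : Fin a × Fin b × Fin c),
      act A B C T x.1 x.2.1 x.2.2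
        = (kroneckerMap (fun x y => x * y) A (kroneckerMap (fun x y => x * y) B C)).mulVec (fun y => T y.1 y.2.1 y.2.2) x := by
    intro A B C T x
    simp only [act, mulVec, dotProduct, Fintype.sum_prod_type, kroneckerMap_apply,
      mul_assoc]
  funext i j k
  rw [key _ _ _ _ (i, j, k), key _ _ _ _ (i, j, k)]
  have h : (fun y : Fin a × Fin b × Fin c => act A' B' C' T y.1 y.2.1 y.2.2)
      = (kroneckerMap (fun x y => x * y) A'
        (kroneckerMap (fun x y => x * y) B' C')).mulVec (fun y => T y.1 y.2.1 y.2.2) :=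
    funext fun y => key _ _ _ _ y
  rw [h, mulVec_mulVec, ← mul_kronecker_mul, ← mul_kronecker_mul]

theorem act_one {a b c : ℕ} (T : Tensor3 a b c) : act 1 1 1 T = T := by
  funext i j k
  simp [act, Matrix.one_apply]

theorem act_smul_smul_smul {a b c : ℕ} (x y z : ℂ) (A : Matrix (Fin a) (Fin a) ℂ)
    (B : Matrix (Fin b) (Fin b) ℂ) (C : Matrix (Fin c) (Fin c) ℂ) (T : Tensor3 a b c) :
    act (x • A) (y • B) (z • C) T = (x * y * z) • act A B C T := by
  funext i j k
  simp only [act, Matrix.smul_apply, smul_eq_mul, Pi.smul_apply, Finset.mul_sum]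
  refine Finset.sum_congr rfl fun i' _ => Finset.sum_congr rfl fun j' _ =>
    Finset.sum_congr rfl fun k' _ => ?_
  ring

theorem act_zero {a b c : ℕ} (A : Matrix (Fin a) (Fin a) ℂ)
    (B : Matrix (Fin b) (Fin b) ℂ) (C : Matrix (Fin c) (Fin c) ℂ) :
    act A B C (0 : Tensor3 a b c) = 0 := by
  funext i j k
  simp [act]

theorem continuous_act {a b c : ℕ} (A : Matrix (Fin a) (Fin a) ℂ)
    (B : Matrix (Fin b) (Fin b) ℂ) (C : Matrix (Fin c) (Fin c) ℂ) :
    Continuous (act A B C) := by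
  unfold act
  fun_prop

theorem mem_glOrbit_of_det_ne_zero {a b c : ℕ} {T : Tensor3 a b c} {A : Matrix (Fin a) (Fin a) ℂ}
    {B : Matrix (Fin b) (Fin b) ℂ} {C : Matrix (Fin c) (Fin c) ℂ} (hA : A.det ≠ 0)
    (hB : B.det ≠ 0) (hC : C.det ≠ 0) : act A B C T ∈ glOrbit T :=
  ⟨Matrix.GeneralLinearGroup.mkOfDetNeZero A hA, Matrix.GeneralLinearGroup.mkOfDetNeZero B hB,
    Matrix.GeneralLinearGroup.mkOfDetNeZero C hC, rfl⟩

theorem mem_slOrbit_of_det_eq_one {a b c : ℕ} {T : Tensor3 a b c} {A : Matrix (Fin a) (Fin a) ℂ}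
    {B : Matrix (Fin b) (Fin b) ℂ} {C : Matrix (Fin c) (Fin c) ℂ} (hA : A.det = 1)
    (hB : B.det = 1) (hC : C.det = 1) : act A B C T ∈ slOrbit T :=
  ⟨⟨A, hA⟩, ⟨B, hB⟩, ⟨C, hC⟩, rfl⟩

/-- Every invertible complex matrix of positive size is a scalar multiple of one of
determinant one. -/
theorem exists_smul_det_eq_one {n : ℕ} (hn : n ≠ 0) (A : Matrix (Fin n) (Fin n) ℂ)
    (hA : A.det ≠ 0) : ∃ (x : ℂ) (A' : Matrix (Fin n) (Fin n) ℂ),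
      x ≠ 0 ∧ A'.det = 1 ∧ A = x • A' := by
  obtain ⟨x, hx⟩ := IsAlgClosed.exists_pow_nat_eq A.det (Nat.pos_of_ne_zero hn)
  have hx0 : x ≠ 0 := by
    rintro rfl
    exact hA (by rw [← hx, zero_pow hn])
  refine ⟨x, x⁻¹ • A, hx0, ?_, by rw [smul_smul, mul_inv_cancel₀ hx0, one_smul]⟩
  rw [Matrix.det_smul, Fintype.card_fin, ← hx, ← mul_pow, inv_mul_cancel₀ hx0, one_pow]

theorem exists_smul_of_mem_glOrbit {a b c : ℕ} (ha : a ≠ 0) (hb : b ≠ 0) (hc : c ≠ 0)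
    {S T : Tensor3 a b c} (h : S ∈ glOrbit T) :
    ∃ x : ℂ, x ≠ 0 ∧ ∃ S' ∈ slOrbit T, S = x • S' := by
  obtain ⟨A, B, C, rfl⟩ := h
  obtain ⟨x, A', hx, hA', hA⟩ := exists_smul_det_eq_one ha A.val A.det_ne_zero
  obtain ⟨y, B', hy, hB', hB⟩ := exists_smul_det_eq_one hb B.val B.det_ne_zero
  obtain ⟨z, C', hz, hC', hC⟩ := exists_smul_det_eq_one hc C.val C.det_ne_zero
  refine ⟨x * y * z, by simp [hx, hy, hz], act A' B' C' T,
    mem_slOrbit_of_det_eq_one hA' hB' hC', ?_⟩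
  rw [hA, hB, hC, act_smul_smul_smul]

end Tensor3

/-! ### The invariant built from maximal minors -/

namespace Tensor3

open Matrix

/-- The signed maximal minors of an `n × (n + 1)` matrix. -/
noncomputable def signedMinors {n : ℕ} (M : Matrix (Fin n) (Fin (n + 1)) ℂ) : Fin (n + 1) → ℂ :=
  fun k => (-1) ^ (k : ℕ) * (M.submatrix id k.succAbove).det

/-- The matrix `M` with the row `w` added on top. -/
def consRow {n : ℕ} (w : Fin (n + 1) → ℂ) (M : Matrix (Fin n) (Fin (n + 1)) ℂ) :
    Matrix (Fin (n + 1)) (Fin (n + 1)) ℂ :=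
  Matrix.of fun i k => Fin.cases (w k) (fun j => M j k) i

theorem consRow_zero {n : ℕ} (w : Fin (n + 1) → ℂ) (M : Matrix (Fin n) (Fin (n + 1)) ℂ)
    (k : Fin (n + 1)) : consRow w M 0 k = w k := rfl

theorem consRow_succ {n : ℕ} (w : Fin (n + 1) → ℂ) (M : Matrix (Fin n) (Fin (n + 1)) ℂ)
    (j : Fin n) (k : Fin (n + 1)) : consRow w M j.succ k = M j k := rfl

theorem det_consRow_eq_dotProduct_signedMinors {n : ℕ} (w : Fin (n + 1) → ℂ)
    (M : Matrix (Fin n) (Fin (n + 1)) ℂ) :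
    (consRow w M).det = w ⬝ᵥ signedMinors M := by
  rw [det_succ_row_zero, dotProduct]
  refine Finset.sum_congr rfl fun k _ => ?_
  have : (consRow w M).submatrix Fin.succ k.succAbove
      = M.submatrix id k.succAbove := by
    ext i j
    simp [consRow_succ]
  rw [this, signedMinors, consRow_zero]
  ring

theorem mulVec_signedMinors {n : ℕ} (M : Matrix (Fin n) (Fin (n + 1)) ℂ) :
    M *ᵥ signedMinors M = 0 := by
  funext j
  change M j ⬝ᵥ signedMinors M = 0
  rw [← det_consRow_eq_dotProduct_signedMinors]
  refine det_zero_of_row_eq (Fin.succ_ne_zero j).symm ?_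
  funext k
  rw [consRow_zero, consRow_succ]

theorem signedMinors_mul_left {n : ℕ} (B : Matrix (Fin n) (Fin n) ℂ)
    (M : Matrix (Fin n) (Fin (n + 1)) ℂ) : signedMinors (B * M) = B.det • signedMinors M := by
  funext k
  have : (B * M).submatrix id k.succAbove = B * M.submatrix id k.succAbove := by
    ext i j
    simp [mul_apply]
  simp only [signedMinors, this, det_mul, Pi.smul_apply, smul_eq_mul]
  ring

/-- Pairing with a row `w` turns both sides into determinants: adding the row `C w` on top of `M Cᵀ`
gives `consRow w M * Cᵀ`. This form avoids inverting `C`. -/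
theorem signedMinors_mul_transpose_vecMul {n : ℕ} (C : Matrix (Fin (n + 1)) (Fin (n + 1)) ℂ)
    (M : Matrix (Fin n) (Fin (n + 1)) ℂ) :
    signedMinors (M * Cᵀ) ᵥ* C = C.det • signedMinors M := by
  have key : ∀ w, w ⬝ᵥ (signedMinors (M * Cᵀ) ᵥ* C) = w ⬝ᵥ (C.det • signedMinors M) := by
    intro w
    rw [dotProduct_comm, ← dotProduct_mulVec, dotProduct_comm,
      ← det_consRow_eq_dotProduct_signedMinors, dotProduct_smul,
      ← det_consRow_eq_dotProduct_signedMinors, smul_eq_mul, mul_comm, ← det_transpose C, ← det_mul]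
    congr 1
    ext i k
    refine Fin.cases ?_ (fun j => ?_) i
    · simp [mul_apply, consRow_zero, mulVec, dotProduct, mul_comm]
    · simp [mul_apply, consRow_succ]
  funext k
  simpa using key (Pi.single k 1)

theorem signedMinors_smul {n : ℕ} (x : ℂ) (M : Matrix (Fin n) (Fin (n + 1)) ℂ) :
    signedMinors (x • M) = x ^ n • signedMinors M := by
  funext k
  simp only [signedMinors, submatrix_smul, Pi.smul_apply, smul_eq_mul, det_smul, Fintype.card_fin]
  ring

/-- The determinant of a binary pencil of square matrices is a binary form. -/
theorem exists_det_smul_add_smul_eq_sum {n : ℕ} (M N : Matrix (Fin n) (Fin n) ℂ) :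
    ∃ f : Fin (n + 1) → ℂ, ∀ x y : ℂ,
      (x • M + y • N).det = ∑ m, f m * (x ^ (m : ℕ) * y ^ (m.rev : ℕ)) := by
  set q : Polynomial ℂ := (((Polynomial.X : Polynomial ℂ) • M.map Polynomial.C +
    N.map Polynomial.C : Matrix (Fin n) (Fin n) (Polynomial ℂ))).det with hq
  have hdeg : q.natDegree ≤ n := by
    simpa using Polynomial.natDegree_det_X_add_C_le M N
  have hcoeff : q.coeff n = M.det := by
    simpa using Polynomial.coeff_det_X_add_C_card M N
  have heval : ∀ x, (x • M + N).det = q.eval x := by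
    intro x
    rw [hq, ← Polynomial.coe_evalRingHom, RingHom.map_det]
    congr 1
    ext i j
    simp
    exact mul_comm _ _
  refine ⟨fun m => q.coeff m, fun x y => ?_⟩
  -- Dehomogenising needs `y ≠ 0`; at `y = 0` only the top coefficient, `det M`, survives.
  rcases eq_or_ne y 0 with rfl | hy
  · rw [Finset.sum_eq_single (Fin.last n)]
    · simp [hcoeff, mul_comm]
    · intro m _ hm
      have : (m.rev : ℕ) ≠ 0 := by
        have := Fin.val_lt_last hm
        rw [Fin.val_rev]
        omega
      rw [zero_pow this, mul_zero, mul_zero]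
    · simp
  · have : x • M + y • N = y • ((x / y) • M + N) := by
      rw [smul_add, smul_smul, mul_div_cancel₀ _ hy]
    rw [this, det_smul, heval, Polynomial.eval_eq_sum_range' (Nat.lt_succ_of_le hdeg),
      Finset.sum_range, Fintype.card_fin, Finset.mul_sum]
    refine Finset.sum_congr rfl fun m _ => ?_
    have hm : y ^ n = y ^ (m : ℕ) * y ^ (m.rev : ℕ) := by
      rw [← pow_add, Fin.val_rev]
      congr 1
      omega
    rw [hm, div_pow]
    field_simp

/-- The matrix `∑ i, p i • T i` of the pencil `T` at the point `p`. -/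
def pencilAt {n : ℕ} (T : Tensor3 2 n (n + 1)) (p : Fin 2 → ℂ) : Matrix (Fin n) (Fin (n + 1)) ℂ :=
  Matrix.of fun j k => ∑ i, p i * T i j k

theorem pencilAt_act {n : ℕ} (A : Matrix (Fin 2) (Fin 2) ℂ) (B : Matrix (Fin n) (Fin n) ℂ)
    (C : Matrix (Fin (n + 1)) (Fin (n + 1)) ℂ) (T : Tensor3 2 n (n + 1)) (p : Fin 2 → ℂ) :
    pencilAt (act A B C T) p = B * pencilAt T (p ᵥ* A) * Cᵀ := by
  ext j k
  simp only [pencilAt, act, of_apply, mul_apply, transpose_apply, vecMul, dotProduct,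
    Fin.sum_univ_two]
  simp only [Finset.mul_sum, Finset.sum_mul, mul_add, ← Finset.sum_add_distrib]
  conv_rhs => rw [Finset.sum_comm]
  refine Finset.sum_congr rfl fun j' _ => Finset.sum_congr rfl fun k' _ => ?_
  ring

/-- The determinant of the matrix of maximal minors of the pencil `T` at `n + 1` points. -/
noncomputable def minorDet {n : ℕ} (p : Fin (n + 1) → Fin 2 → ℂ) (T : Tensor3 2 n (n + 1)) : ℂ :=
  (Matrix.of fun i => signedMinors (pencilAt T (p i))).det

theorem minorDet_smul {n : ℕ} (p : Fin (n + 1) → Fin 2 → ℂ) (x : ℂ) (T : Tensor3 2 n (n + 1)) :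
    minorDet p (x • T) = x ^ (n * (n + 1)) * minorDet p T := by
  have h : ∀ q, pencilAt (x • T) q = x • pencilAt T q := by
    intro q
    ext j k
    simp only [pencilAt, of_apply, Pi.smul_apply, smul_eq_mul, Matrix.smul_apply, Finset.mul_sum]
    refine Finset.sum_congr rfl fun i _ => ?_
    ring
  have h' : (Matrix.of fun i => signedMinors (pencilAt (x • T) (p i)))
      = x ^ n • Matrix.of fun i => signedMinors (pencilAt T (p i)) := by
    ext i k
    simp [h, signedMinors_smul]
  rw [minorDet, h', det_smul, Fintype.card_fin, ← pow_mul, minorDet]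

/-- The dependence of `minorDet` on the points is through a projective Vandermonde determinant. -/
theorem exists_minorDet_eq_mul_det_projVandermonde {n : ℕ} (T : Tensor3 2 n (n + 1)) :
    ∃ f : ℂ, ∀ p : Fin (n + 1) → Fin 2 → ℂ,
      minorDet p T = f * (projVandermonde (fun i => p i 0) (fun i => p i 1)).det := by
  have h : ∀ k : Fin (n + 1), ∃ f : Fin (n + 1) → ℂ, ∀ q : Fin 2 → ℂ,
      signedMinors (pencilAt T q) k = ∑ m, f m * (q 0 ^ (m : ℕ) * q 1 ^ (m.rev : ℕ)) := by
    intro k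
    obtain ⟨f, hf⟩ := exists_det_smul_add_smul_eq_sum
      ((Matrix.of (T 0)).submatrix id k.succAbove) ((Matrix.of (T 1)).submatrix id k.succAbove)
    refine ⟨fun m => (-1) ^ (k : ℕ) * f m, fun q => ?_⟩
    have : (pencilAt T q).submatrix id k.succAbove =
        q 0 • (Matrix.of (T 0)).submatrix id k.succAbove +
          q 1 • (Matrix.of (T 1)).submatrix id k.succAbove := by
      ext i j
      simp [pencilAt]
    rw [signedMinors, this, hf, Finset.mul_sum]
    refine Finset.sum_congr rfl fun m _ => ?_
    ring
  choose f hf using h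
  refine ⟨(Matrix.of fun m k => f k m).det, fun p => ?_⟩
  rw [mul_comm, ← det_mul, minorDet]
  congr 1
  ext i k
  rw [of_apply, hf, mul_apply]
  refine Finset.sum_congr rfl fun m _ => ?_
  simp only [projVandermonde_apply, of_apply]
  ring

/-- `B` and `C` contribute only their determinants, while `A` moves the points. The projective
Vandermonde determinant is a product of `2 × 2` brackets of points, each multiplied by `det A = 1`.
-/
theorem minorDet_act {n : ℕ} (p : Fin (n + 1) → Fin 2 → ℂ) {A : Matrix (Fin 2) (Fin 2) ℂ}
    {B : Matrix (Fin n) (Fin n) ℂ} {C : Matrix (Fin (n + 1)) (Fin (n + 1)) ℂ} (hA : A.det = 1)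
    (hB : B.det = 1) (hC : C.det = 1) (T : Tensor3 2 n (n + 1)) :
    minorDet p (act A B C T) = minorDet p T := by
  have h1 : minorDet p (act A B C T) = minorDet (fun i => p i ᵥ* A) T := by
    rw [minorDet, minorDet, ← mul_one (det _), ← hC, ← det_mul]
    congr 1
    ext i k
    have := congrFun (signedMinors_mul_transpose_vecMul C (B * pencilAt T (p i ᵥ* A))) k
    rw [← pencilAt_act, signedMinors_mul_left, hB, hC, one_smul, one_smul] at this
    rw [of_apply, ← this]
    simp [mul_apply, vecMul, dotProduct]
  obtain ⟨f, hf⟩ := exists_minorDet_eq_mul_det_projVandermonde T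
  rw [h1, hf, hf, det_projVandermonde, det_projVandermonde]
  congr 1
  refine Finset.prod_congr rfl fun i _ => Finset.prod_congr rfl fun j _ => ?_
  rw [det_fin_two] at hA
  simp only [vecMul, dotProduct, Fin.sum_univ_two]
  linear_combination (p j 0 * p i 1 - p i 0 * p j 1) * hA

theorem differentiable_minorDet_line {n : ℕ} (p : Fin (n + 1) → Fin 2 → ℂ)
    (S T : Tensor3 2 n (n + 1)) : Differentiable ℂ fun z : ℂ => minorDet p (S + z • T) := by
  simp only [minorDet, signedMinors, pencilAt, det_apply', of_apply, submatrix_apply, Pi.add_apply,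
    Pi.smul_apply]
  fun_prop

theorem continuous_minorDet {n : ℕ} (p : Fin (n + 1) → Fin 2 → ℂ) :
    Continuous (minorDet (n := n) p) := by
  unfold minorDet signedMinors pencilAt
  simp only [det_apply', of_apply, submatrix_apply]
  fun_prop

theorem polyMul_apply {a b c : ℕ} (h : a + b = c + 1) (i : Fin a) (j : Fin b) (k : Fin c) :
    polyMul a b c h i j k = if (k : ℕ) = i + j then 1 else 0 := by
  simp only [polyMul, Finset.sum_apply, tmul]
  rw [Finset.sum_eq_single i, Finset.sum_eq_single j]
  · simp [Pi.single_apply, Fin.ext_iff]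
  · intro j' _ hj
    simp [Pi.single_apply, hj.symm]
  · simp
  · intro i' _ hi
    simp [Pi.single_apply, hi.symm]
  · simp

/-- Evaluation points `(i, 1)`, `i = 0, …, n`. -/
def affinePoints (n : ℕ) : Fin (n + 1) → Fin 2 → ℂ := fun i => ![(i : ℂ), 1]

/-- Only the minor omitting column `0` is computed, being unitriangular. The minors form a kernel
vector `v`, and row `j` reads `x v_j + v_(j+1) = 0`, which gives the rest. -/
theorem signedMinors_pencilAt_polyMul {n : ℕ} (h : 2 + n = n + 1 + 1) (x : ℂ) (k : Fin (n + 1)) :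
    signedMinors (pencilAt (polyMul 2 n (n + 1) h) ![x, 1]) k = (-x) ^ (k : ℕ) := by
  set M := pencilAt (polyMul 2 n (n + 1) h) ![x, 1] with hM
  have hMa : ∀ (j : Fin n) (k : Fin (n + 1)), M j k =
      (if (k : ℕ) = j then x else 0) + if (k : ℕ) = j + 1 then 1 else 0 := by
    intro j k
    simp [hM, pencilAt, polyMul_apply, Fin.sum_univ_two, add_comm 1 (j : ℕ)]
  induction k using Fin.induction with
  | zero =>
    have : (M.submatrix id (Fin.succAbove 0)).BlockTriangular OrderDual.toDual := by
      intro i j hij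
      have hij : i < j := hij
      have : (i : ℕ) < j := hij
      simp only [submatrix_apply, id, hMa, Fin.zero_succAbove, Fin.val_succ]
      rw [if_neg (by omega), if_neg (by omega), add_zero]
    rw [signedMinors, det_of_isLowerTriangular _ this]
    simp [hMa]
  | succ j ih =>
    have := congrFun (mulVec_signedMinors M) j
    simp only [mulVec, dotProduct, hMa, Pi.zero_apply, add_mul, Finset.sum_add_distrib, ite_mul,
      zero_mul, one_mul] at this
    rw [Finset.sum_eq_single j.castSucc, Finset.sum_eq_single j.succ, if_pos (by simp),
      if_pos (by simp), ih] at this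
    · rw [eq_neg_of_add_eq_zero_right this, Fin.val_succ, Fin.val_castSucc]
      ring
    · intro b _ hb
      rw [if_neg]
      intro hb'
      exact hb (Fin.ext (by simpa using hb'))
    · simp
    · intro b _ hb
      rw [if_neg]
      intro hb'
      exact hb (Fin.ext (by simpa using hb'))
    · simp

theorem minorDet_polyMul_ne_zero {n : ℕ} (h : 2 + n = n + 1 + 1) :
    minorDet (affinePoints n) (polyMul 2 n (n + 1) h) ≠ 0 := by
  have : (Matrix.of fun i => signedMinors (pencilAt (polyMul 2 n (n + 1) h) (affinePoints n i)))
      = vandermonde fun i : Fin (n + 1) => -((i : ℕ) : ℂ) := by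
    ext i k
    rw [of_apply, affinePoints, signedMinors_pencilAt_polyMul, vandermonde_apply]
  rw [minorDet, this, det_vandermonde_ne_zero_iff]
  intro i j hij
  exact Fin.ext (by simpa using hij)

end Tensor3

/-! ### Destabilising one-parameter subgroups -/

namespace Tensor3

open Matrix Module Filter Topology

/-- A basis adapted to a subspace. -/
theorem exists_basis_adapted {N : ℕ} (W : Submodule ℂ (Fin N → ℂ)) :
    ∃ (b : Basis (Fin N) ℂ (Fin N → ℂ)) (S : Finset (Fin N)), S.card = finrank ℂ W ∧
      (∀ j ∈ S, b j ∈ W) ∧ ∀ x ∈ W, ∀ j ∉ S, b.repr x j = 0 := by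
  obtain ⟨W', hW⟩ := W.exists_isCompl
  let b₀ := ((finBasis ℂ W).prod (finBasis ℂ W')).map (W.prodEquivOfIsCompl W' hW)
  have hcard : Fintype.card (Fin (finrank ℂ W) ⊕ Fin (finrank ℂ W')) = Fintype.card (Fin N) := by
    rw [← finrank_eq_card_basis b₀, finrank_fin_fun, Fintype.card_fin]
  let e := Fintype.equivOfCardEq hcard
  refine ⟨b₀.reindex e, Finset.univ.image (e ∘ Sum.inl), ?_, ?_, ?_⟩
  · rw [Finset.card_image_of_injective _ (e.injective.comp Sum.inl_injective), Finset.card_univ,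
      Fintype.card_fin]
  · intro j hj
    obtain ⟨i, -, rfl⟩ := Finset.mem_image.1 hj
    simp [b₀]
  · intro x hx j hj
    obtain ⟨i | i, rfl⟩ := e.surjective j
    · exact absurd (Finset.mem_image.2 ⟨i, Finset.mem_univ _, rfl⟩) hj
    · have : (W.prodEquivOfIsCompl W' hW).symm x = (⟨x, hx⟩, 0) :=
        Submodule.prodEquivOfIsCompl_symm_apply_left W W' hW ⟨x, hx⟩
      simp [b₀, this]

theorem prod_zpow_eq_zpow_sum {ι : Type*} (s : Finset ι) {x : ℂ} (hx : x ≠ 0) (f : ι → ℤ) :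
    ∏ i ∈ s, x ^ f i = x ^ ∑ i ∈ s, f i := by
  classical
  induction s using Finset.induction_on with
  | empty => simp
  | insert i s hi ih => rw [Finset.prod_insert hi, Finset.sum_insert hi, zpow_add₀ hx, ih]

theorem sum_ite_mem_weight {N : ℕ} (S : Finset (Fin N)) (a b : ℤ) :
    (∑ i, if i ∈ S then a else b) = S.card * a + ((N : ℤ) - S.card) * b := by
  have h : S.card ≤ N := by simpa using S.card_le_univ
  rw [Finset.sum_ite, Finset.sum_const, Finset.sum_const, Finset.filter_mem_eq_inter,
    Finset.univ_inter, Finset.filter_not, Finset.filter_mem_eq_inter, Finset.univ_inter,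
    ← Finset.compl_eq_univ_sdiff, Finset.card_compl, Fintype.card_fin, nsmul_eq_mul, nsmul_eq_mul,
    Nat.cast_sub h]

theorem tendsto_zpow_nhdsNE_zero {w : ℤ} (hw : 0 < w) :
    Tendsto (fun s : ℂ => s ^ w) (𝓝[≠] 0) (𝓝 0) := by
  lift w to ℕ using hw.le
  have h : Continuous fun s : ℂ => s ^ w := continuous_pow w
  have := h.tendsto 0
  rw [zero_pow (by exact_mod_cast hw.ne')] at this
  simpa using this.mono_left nhdsWithin_le_nhds

/-- A one-parameter subgroup of positive weights destabilises. -/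
theorem slUnstable_of_weights {a b c : ℕ} {T : Tensor3 a b c} {B B' : Matrix (Fin b) (Fin b) ℂ}
    {C C' : Matrix (Fin c) (Fin c) ℂ} (hB : B' * B = 1) (hC : C' * C = 1)
    (wB : Fin b → ℤ) (wC : Fin c → ℤ) (hwB : ∑ j, wB j = 0) (hwC : ∑ k, wC k = 0)
    (h : ∀ i j k, act 1 B C T i j k ≠ 0 → 0 < wB j + wC k) : SLUnstable T := by
  let D : ℂ → Matrix (Fin b) (Fin b) ℂ := fun s => diagonal fun j => s ^ wB j
  let E : ℂ → Matrix (Fin c) (Fin c) ℂ := fun s => diagonal fun k => s ^ wC k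
  have hlim : Tendsto (fun s => act 1 (D s) (E s) (act 1 B C T)) (𝓝[≠] 0) (𝓝 0) := by
    rw [tendsto_pi_nhds]
    intro i
    rw [tendsto_pi_nhds]
    intro j
    rw [tendsto_pi_nhds]
    intro k
    generalize act 1 B C T = T' at h
    have hval : ∀ s, act 1 (D s) (E s) T' i j k = s ^ wB j * s ^ wC k * T' i j k := by
      intro s
      simp only [act, D, E, one_apply, diagonal_apply]
      rw [Finset.sum_eq_single i, Finset.sum_eq_single j, Finset.sum_eq_single k]
      · simp
      · intro k' _ hk
        simp [hk.symm]
      · simp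
      · intro j' _ hj
        simp [hj.symm]
      · simp
      · intro i' _ hi
        simp [hi.symm]
      · simp
    by_cases h0 : T' i j k = 0
    · simp [hval, h0]
    · have hT : Tendsto (fun s : ℂ => s ^ (wB j + wC k) * T' i j k) (𝓝[≠] 0)
          (𝓝 (0 * T' i j k)) := (tendsto_zpow_nhdsNE_zero (h i j k h0)).mul_const _
      rw [zero_mul] at hT
      refine hT.congr' ?_
      filter_upwards [self_mem_nhdsWithin] with s hs
      rw [hval, zpow_add₀ hs]
  -- `B` and `C` need not have determinant one; undoing the base change puts the curve in the
  -- `SL`-orbit.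
  have hlim' : Tendsto (fun s => act 1 B' C' (act 1 (D s) (E s) (act 1 B C T))) (𝓝[≠] 0)
      (𝓝 0) := by
    have := ((continuous_act 1 B' C').tendsto 0).comp hlim
    rwa [act_zero] at this
  refine mem_closure_of_tendsto hlim' ?_
  filter_upwards [self_mem_nhdsWithin] with s hs
  rw [act_act, act_act]
  refine mem_slOrbit_of_det_eq_one (by simp) ?_ ?_
  · rw [det_mul, det_mul, det_diagonal, prod_zpow_eq_zpow_sum _ hs, hwB, zpow_zero, mul_one,
      ← det_mul, hB, det_one]
  · rw [det_mul, det_mul, det_diagonal, prod_zpow_eq_zpow_sum _ hs, hwC, zpow_zero, mul_one,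
      ← det_mul, hC, det_one]

/-- The linear map `ℂ^c → ℂ^b` given by the `i`-th slice of a tensor. -/
noncomputable def slice {a b c : ℕ} (T : Tensor3 a b c) (i : Fin a) :
    (Fin c → ℂ) →ₗ[ℂ] (Fin b → ℂ) :=
  (Matrix.of (T i)).mulVecLin

/-- In bases adapted to `U` and `W` both slices have a zero block, from `U` to the complement of
`W`. Weights of sum zero can be negative on this block and positive on the other three. -/
theorem slUnstable_of_map_slice_le {n : ℕ} (T : Tensor3 2 n (n + 1))
    (U : Submodule ℂ (Fin (n + 1) → ℂ)) (W : Submodule ℂ (Fin n → ℂ))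
    (hUW : ∀ i, U.map (slice T i) ≤ W) (hW : finrank ℂ W < n) (h : finrank ℂ W < finrank ℂ U) :
    SLUnstable T := by
  obtain ⟨bU, SU, hSU, hbU, -⟩ := exists_basis_adapted U
  obtain ⟨bW, SW, hSW, -, hbW⟩ := exists_basis_adapted W
  rw [← hSU, ← hSW] at h
  rw [← hSW] at hW
  have hact : ∀ i j k, act 1 (bW.toMatrix (Pi.basisFun ℂ (Fin n)))
      ((Pi.basisFun ℂ (Fin (n + 1))).toMatrix bU)ᵀ T i j k = bW.repr (slice T i (bU k)) j := by
    intro i j k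
    rw [← Basis.toMatrix_mulVec_repr (Pi.basisFun ℂ (Fin n)) bW]
    simp only [act, one_apply, ite_mul, one_mul, zero_mul, slice, mulVecLin_apply, mulVec,
      dotProduct, Pi.basisFun_repr, of_apply, transpose_apply, Basis.toMatrix_apply, Finset.mul_sum]
    rw [Finset.sum_eq_single i]
    · refine Finset.sum_congr rfl fun j' _ => Finset.sum_congr rfl fun k' _ => ?_
      simp
      ring
    · intro i' _ hi
      simp [hi.symm]
    · simp
  refine slUnstable_of_weights (B := bW.toMatrix (Pi.basisFun ℂ (Fin n)))
    (B' := (Pi.basisFun ℂ (Fin n)).toMatrix bW)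
    (C := ((Pi.basisFun ℂ (Fin (n + 1))).toMatrix bU)ᵀ)
    (C' := (bU.toMatrix (Pi.basisFun ℂ (Fin (n + 1))))ᵀ)
    (Basis.toMatrix_mul_toMatrix_flip _ _) ?_
    -- With `p = dim U` and `q = dim W`, both diagonal blocks get weight `n p - (n + 1) q = n (p -
    -- q) - q ≥ n - q > 0`.
    (fun j => if j ∈ SW then ((n : ℤ) + 1) * (n - SW.card) else -((n + 1) * SW.card))
    (fun k => if k ∈ SU then -(n * ((n : ℤ) + 1 - SU.card)) else n * SU.card) ?_ ?_ ?_
  · rw [← transpose_mul, Basis.toMatrix_mul_toMatrix_flip, transpose_one]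
  · rw [sum_ite_mem_weight]
    ring
  · rw [sum_ite_mem_weight]
    push_cast
    ring
  · intro i j k hne
    rw [hact] at hne
    have hq : (SW.card : ℤ) + 1 ≤ n := by exact_mod_cast hW
    have hp : (SW.card : ℤ) + 1 ≤ SU.card := by exact_mod_cast h
    have hn : (0 : ℤ) ≤ n := by positivity
    have hq0 : (0 : ℤ) ≤ SW.card := by positivity
    by_cases hk : k ∈ SU <;> by_cases hj : j ∈ SW
    · simp only [hk, hj, if_true]
      nlinarith
    · exact absurd (hbW _ (hUW i (Submodule.mem_map_of_mem (hbU k hk))) j hj) hne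
    · simp only [hk, hj, if_true, if_false]
      nlinarith
    · simp only [hk, hj, if_false]
      nlinarith

end Tensor3

/-! ### Kernel chains of a pencil and the normal form -/

namespace Tensor3

open Module

section Chain

variable {K E F : Type*} [Field K] [AddCommGroup E] [Module K E] [AddCommGroup F] [Module K F]

/-- The subspace of all endpoints `u (m - 1)` of chains `g (u 0) = 0`, `g (u (i + 1)) = f (u i)`. -/
def chainSubmodule (f g : E →ₗ[K] F) : ℕ → Submodule K E
  | 0 => ⊥
  | m + 1 => ((chainSubmodule f g m).map f).comap g

theorem chainSubmodule_monotone (f g : E →ₗ[K] F) : Monotone (chainSubmodule f g) := by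
  refine monotone_nat_of_le_succ fun m => ?_
  induction m with
  | zero => exact bot_le
  | succ m ih => exact Submodule.comap_mono (Submodule.map_mono ih)

theorem finrank_add_le_finrank_comap_add [FiniteDimensional K E] [FiniteDimensional K F]
    (g : E →ₗ[K] F) (W : Submodule K F) :
    finrank K E + finrank K W ≤ finrank K (W.comap g) + finrank K F := by
  have h1 := LinearMap.finrank_range_add_finrank_ker (W.mkQ ∘ₗ g)
  rw [LinearMap.ker_comp, Submodule.ker_mkQ] at h1
  have h2 := Submodule.finrank_le (LinearMap.range (W.mkQ ∘ₗ g))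
  have h3 := W.finrank_quotient_add_finrank
  omega

/-- The chain stabilises at some `V = g⁻¹(f V)`. If `f` were injective on `V`, then `dim f V = dim
V`, and the bound on the codimension of a preimage would give `dim E ≤ dim F`. -/
theorem exists_mem_chainSubmodule_ker [FiniteDimensional K E] [FiniteDimensional K F]
    (f g : E →ₗ[K] F) (h : finrank K F < finrank K E) :
    ∃ m, ∃ x ∈ chainSubmodule f g m, x ≠ 0 ∧ f x = 0 := by
  obtain ⟨N, hN⟩ := monotone_stabilizes_iff_noetherian.2 (inferInstance : IsNoetherian K E)
    ⟨chainSubmodule f g, chainSubmodule_monotone f g⟩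
  have hN : chainSubmodule f g N = ((chainSubmodule f g N).map f).comap g := hN (N + 1) N.le_succ
  by_contra! hcon
  have hinj : Function.Injective (f.domRestrict (chainSubmodule f g N)) := by
    rw [injective_iff_map_eq_zero]
    intro x hx
    by_contra hx0
    exact hcon N x x.2 (by simpa using hx0) hx
  have h1 := LinearMap.finrank_range_of_inj hinj
  rw [LinearMap.range_domRestrict] at h1
  have h2 := finrank_add_le_finrank_comap_add g ((chainSubmodule f g N).map f)
  rw [← hN] at h2
  omega

theorem exists_chain_of_mem_chainSubmodule (f g : E →ₗ[K] F) (d : ℕ) {x : E}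
    (hx : x ∈ chainSubmodule f g (d + 1)) :
    ∃ u : ℕ → E, u d = x ∧ g (u 0) = 0 ∧ ∀ i < d, g (u (i + 1)) = f (u i) := by
  induction d generalizing x with
  | zero =>
    refine ⟨fun _ => x, rfl, ?_, by simp⟩
    simpa [chainSubmodule] using hx
  | succ d ih =>
    obtain ⟨y, hy, hyx⟩ := Submodule.mem_map.1 (Submodule.mem_comap.1 hx)
    obtain ⟨u, hud, hu0, hu⟩ := ih hy
    refine ⟨fun i => if i ≤ d then u i else x, by simp, by simpa using hu0, fun i hi => ?_⟩
    rcases (Nat.lt_succ_iff.1 hi).lt_or_eq with hid | rfl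
    · simpa [hid, hid.le, Nat.succ_le_of_lt hid] using hu i hid
    · simp [hud, hyx]

/-- A pencil `f, g : E → F` with `dim F < dim E` has a polynomial kernel vector whose coefficients
are linearly independent. -/
theorem exists_linearIndependent_chain [FiniteDimensional K E] [FiniteDimensional K F]
    (f g : E →ₗ[K] F) (h : finrank K F < finrank K E) :
    ∃ (d : ℕ) (u : ℕ → E), LinearIndependent K (fun i : Fin (d + 1) => u i) ∧ g (u 0) = 0 ∧
      (∀ i < d, g (u (i + 1)) = f (u i)) ∧ f (u d) = 0 := by
  classical
  have hex := exists_mem_chainSubmodule_ker f g h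
  obtain ⟨x, hx, hx0, hfx⟩ := Nat.find_spec hex
  have hmin := fun m => Nat.find_min hex (m := m)
  rcases hd : Nat.find hex with _ | d
  · rw [hd] at hx
    exact absurd (by simpa [chainSubmodule] using hx) hx0
  rw [hd] at hx hmin
  obtain ⟨u, rfl, hu0, hu⟩ := exists_chain_of_mem_chainSubmodule f g d hx
  refine ⟨d, u, ?_, hu0, hu, hfx⟩
  -- If `u e` lay one step too low, so would every later term up to `u d`, against the minimality of
  -- `d + 1`. Thus each `u e` lies outside a subspace containing all earlier terms, which gives
  -- independence.
  have hnot : ∀ r e, e + r = d → u e ∉ chainSubmodule f g e := by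
    intro r
    induction r with
    | zero =>
      rintro e rfl he
      exact hmin e (Nat.lt_succ_self _) ⟨u e, he, hx0, hfx⟩
    | succ r ih =>
      intro e hr he
      refine ih (e + 1) (by omega) ?_
      rw [chainSubmodule, Submodule.mem_comap, hu e (by omega)]
      exact Submodule.mem_map_of_mem he
  have hmem : ∀ e ≤ d, u e ∈ chainSubmodule f g (e + 1) := by
    intro e
    induction e with
    | zero => simp [chainSubmodule, hu0]
    | succ e ih =>
      intro he
      rw [chainSubmodule, Submodule.mem_comap, hu e (by omega)]
      exact Submodule.mem_map_of_mem (ih (by omega))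
  have hli : ∀ e ≤ d + 1, LinearIndependent K (fun i : Fin e => u i) := by
    intro e
    induction e with
    | zero => exact fun _ => linearIndependent_empty_type
    | succ e ih =>
      intro he
      rw [linearIndependent_finSucc']
      refine ⟨ih (by omega), fun hspan => hnot (d - e) e (by omega) ?_⟩
      refine (Submodule.span_le.2 ?_ : Submodule.span K _ ≤ chainSubmodule f g e) hspan
      rintro _ ⟨i, rfl⟩
      exact chainSubmodule_monotone f g (Nat.succ_le_of_lt i.2) (hmem i (by have := i.2; omega))
  exact hli (d + 1) le_rfl

end Chain

open Matrix

/-- In the bases `u k` and `w j = slice T 0 (u j)`, the slices send `u k` to `w k` and to `w (k -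
1)`, with `w n` and `w (-1)` read as zero. These are the slices of the multiplication tensor. -/
theorem mem_glOrbit_polyMul_of_chain {n : ℕ} (hn : 2 + n = n + 1 + 1) (T : Tensor3 2 n (n + 1))
    (u : ℕ → Fin (n + 1) → ℂ) (hu : LinearIndependent ℂ (fun k : Fin (n + 1) => u k))
    (hw : LinearIndependent ℂ (fun j : Fin n => slice T 0 (u j))) (h0 : slice T 1 (u 0) = 0)
    (h1 : ∀ i < n, slice T 1 (u (i + 1)) = slice T 0 (u i)) (hd : slice T 0 (u n) = 0) :
    T ∈ glOrbit (polyMul 2 n (n + 1) hn) := by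
  let Q : Matrix (Fin (n + 1)) (Fin (n + 1)) ℂ := Matrix.of fun k => u k
  let B : Matrix (Fin n) (Fin n) ℂ := (Matrix.of fun j : Fin n => slice T 0 (u j))ᵀ
  have hQ : IsUnit Q := linearIndependent_rows_iff_isUnit.1 hu
  have hQd : IsUnit Q.det := (isUnit_iff_isUnit_det Q).1 hQ
  have hB : B.det ≠ 0 := by
    rw [det_transpose]
    exact ((isUnit_iff_isUnit_det _).1 (linearIndependent_rows_iff_isUnit.1 hw)).ne_zero
  have hlhs : ∀ i j k, act 1 1 Q T i j k = slice T i (u k) j := by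
    intro i j k
    simp [act, one_apply, Q, slice, mulVec, dotProduct, mul_comm]
  have hrhs : ∀ i j k, act 1 B 1 (polyMul 2 n (n + 1) hn) i j k =
      ∑ j' : Fin n, if (k : ℕ) = i + j' then slice T 0 (u j') j else 0 := by
    intro i j k
    rw [act, Finset.sum_eq_single i]
    · refine Finset.sum_congr rfl fun j' _ => ?_
      rw [Finset.sum_eq_single k]
      · simp [B, polyMul_apply]
      · intro k' _ hk
        simp [hk.symm]
      · simp
    · intro i' _ hi
      simp [hi.symm]
    · simp
  have key : act 1 1 Q T = act 1 B 1 (polyMul 2 n (n + 1) hn) := by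
    funext i j k
    rw [hlhs, hrhs]
    fin_cases i
    · refine Fin.lastCases ?_ (fun k => ?_) k
      · rw [Finset.sum_eq_zero]
        · simp [hd]
        · intro j' _
          have := j'.2
          rw [if_neg]
          simp
          omega
      · rw [Finset.sum_eq_single k]
        · simp
        · intro j' _ hj
          rw [if_neg]
          simpa [Fin.ext_iff, eq_comm] using hj
        · simp
    · refine Fin.cases ?_ (fun k => ?_) k
      · rw [Finset.sum_eq_zero]
        · simp [h0]
        · intro j' _
          rw [if_neg]
          simp
          omega
      · rw [Finset.sum_eq_single k]
        · simp [add_comm 1, h1]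
        · intro j' _ hj
          rw [if_neg]
          have := Fin.val_ne_of_ne hj
          simp
          omega
        · simp
  have hT : T = act 1 B Q⁻¹ (polyMul 2 n (n + 1) hn) := by
    have := congrArg (act 1 1 Q⁻¹) key
    rw [act_act, act_act, nonsing_inv_mul _ hQd] at this
    simpa [act_one] using this
  rw [hT]
  refine mem_glOrbit_of_det_ne_zero (by simp) hB ?_
  exact (isUnit_nonsing_inv_det _ hQd).ne_zero

/-- Both slices map the span `U` of the chain into the span `W` of its images, and `dim W ≤ d < dim
U`. Either `dim W < n` and this pair destabilises, or `d = n` and the chain supplies bases. -/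
theorem slUnstable_or_mem_glOrbit_polyMul {n : ℕ} (hn : 2 + n = n + 1 + 1)
    (T : Tensor3 2 n (n + 1)) : SLUnstable T ∨ T ∈ glOrbit (polyMul 2 n (n + 1) hn) := by
  obtain ⟨d, u, hu, h0, h1, hd⟩ := exists_linearIndependent_chain (slice T 0) (slice T 1) (by simp)
  set U := Submodule.span ℂ (Set.range fun i : Fin (d + 1) => u i) with hU
  set W := Submodule.span ℂ (Set.range fun i : Fin d => slice T 0 (u i)) with hW
  have hUd : finrank ℂ U = d + 1 := by simpa using finrank_span_eq_card hu
  have hWd : finrank ℂ W ≤ d := 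
    (finrank_range_le_card (R := ℂ) fun i : Fin d => slice T 0 (u i)).trans (by simp)
  have hdn : d ≤ n := by simpa using hu.fintype_card_le_finrank
  rcases lt_or_ge (finrank ℂ W) n with hlt | hge
  · left
    refine slUnstable_of_map_slice_le T U W (fun i => ?_) hlt (by omega)
    rw [hU, Submodule.map_span_le]
    have hmem : ∀ i < d, slice T 0 (u i) ∈ W := fun i hi => Submodule.subset_span ⟨⟨i, hi⟩, rfl⟩
    rintro _ ⟨k, rfl⟩
    fin_cases i
    · rcases (Nat.lt_succ_iff.1 k.2).lt_or_eq with hk | hk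
      · exact hmem k hk
      · simp [hk, hd]
    · rcases k with ⟨_ | k, hk⟩
      · simp [h0]
      · have hk : k < d := by omega
        simpa [h1 k hk] using hmem k hk
  · right
    obtain rfl : d = n := by omega
    refine mem_glOrbit_polyMul_of_chain hn T u hu ?_ h0 h1 hd
    rw [linearIndependent_iff_card_eq_finrank_span, Fintype.card_fin]
    exact le_antisymm hge hWd

end Tensor3

/-! ### Semistability, density and closedness -/

namespace Tensor3

open Topology Filter

theorem minorDet_eq_of_mem_slOrbit {n : ℕ} (p : Fin (n + 1) → Fin 2 → ℂ)
    {S T : Tensor3 2 n (n + 1)} (h : S ∈ slOrbit T) : minorDet p S = minorDet p T := by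
  obtain ⟨A, B, C, rfl⟩ := h
  exact minorDet_act p A.2 B.2 C.2 T

theorem slSemistable_of_minorDet_ne_zero {n : ℕ} (hn : n ≠ 0) {p : Fin (n + 1) → Fin 2 → ℂ}
    {T : Tensor3 2 n (n + 1)} (h : minorDet p T ≠ 0) : SLSemistable T := by
  intro h0
  have hclosed : IsClosed {S | minorDet p S = minorDet p T} :=
    isClosed_eq (continuous_minorDet p) continuous_const
  have hzero : minorDet p 0 = minorDet p T :=
    closure_minimal (fun S hS => minorDet_eq_of_mem_slOrbit p hS) hclosed h0
  have := minorDet_smul p 0 (0 : Tensor3 2 n (n + 1))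
  rw [smul_zero, zero_pow (by simp [hn]), zero_mul] at this
  exact h (hzero.symm.trans this)

theorem slSemistable_iff_mem_glOrbit_polyMul {n : ℕ} (hn : n ≠ 0) (h : 2 + n = n + 1 + 1)
    (T : Tensor3 2 n (n + 1)) : SLSemistable T ↔ T ∈ glOrbit (polyMul 2 n (n + 1) h) := by
  refine ⟨fun hT => (slUnstable_or_mem_glOrbit_polyMul h T).resolve_left hT, fun hT => ?_⟩
  obtain ⟨x, hx, S, hS, rfl⟩ := exists_smul_of_mem_glOrbit two_ne_zero hn n.succ_ne_zero hT
  refine slSemistable_of_minorDet_ne_zero hn (p := affinePoints n) ?_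
  rw [minorDet_smul, minorDet_eq_of_mem_slOrbit _ hS]
  exact mul_ne_zero (pow_ne_zero _ hx) (minorDet_polyMul_ne_zero h)

/-- On the complex line from `T` to `P` the invariant is entire and nonzero at `z = 1`. By the
identity theorem it is nonzero at points arbitrarily close to `z = 0`. -/
theorem dense_glOrbit_polyMul {n : ℕ} (hn : n ≠ 0) (h : 2 + n = n + 1 + 1) :
    Dense (glOrbit (polyMul 2 n (n + 1) h)) := by
  intro T
  set P := polyMul 2 n (n + 1) h
  let φ : ℂ → ℂ := fun z => minorDet (affinePoints n) (T + z • (P - T))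
  have hφ : AnalyticOnNhd ℂ φ Set.univ :=
    (differentiable_minorDet_line _ T (P - T)).differentiableOn.analyticOnNhd isOpen_univ
  have hfreq : ∃ᶠ z in 𝓝 (0 : ℂ), φ z ≠ 0 := by
    intro hev
    have hev : φ =ᶠ[𝓝 0] 0 := by
      filter_upwards [hev] with z hz
      simpa using hz
    have := hφ.eqOn_zero_of_preconnected_of_eventuallyEq_zero isPreconnected_univ
      (Set.mem_univ 0) hev (Set.mem_univ 1)
    refine minorDet_polyMul_ne_zero h ?_
    simpa [φ] using this
  have hlim : Tendsto (fun z : ℂ => T + z • (P - T)) (𝓝 0) (𝓝 T) := by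
    have : Continuous fun z : ℂ => T + z • (P - T) := by fun_prop
    simpa using this.tendsto 0
  refine mem_closure_of_frequently_of_tendsto (hfreq.mono fun z hz => ?_) hlim
  exact (slSemistable_iff_mem_glOrbit_polyMul hn h _).1 (slSemistable_of_minorDet_ne_zero hn hz)

theorem smul_mem_slOrbit {a n : ℕ} {S T : Tensor3 a n (n + 1)} (hS : S ∈ slOrbit T)
    {x : ℂ} (hx : x ^ (n * (n + 1)) = 1) : x • S ∈ slOrbit T := by
  rcases Nat.eq_zero_or_pos n with rfl | hn
  · rwa [show x • S = S from funext fun i => funext fun j => j.elim0]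
  have hx0 : x ≠ 0 := by
    rintro rfl
    rw [zero_pow (by positivity)] at hx
    exact zero_ne_one hx
  obtain ⟨A, B, C, rfl⟩ := hS
  have : x • act A.val B.val C.val T =
      -- The exponents `n + 1` and `-n` add up to `1`, and both determinants become powers of `x ^
      -- (n * (n + 1)) = 1`.
      act A.val (x ^ (n + 1) • B.val) ((x ^ n)⁻¹ • C.val) T := by
    have := act_smul_smul_smul 1 (x ^ (n + 1)) (x ^ n)⁻¹ A.val B.val C.val T
    rw [one_smul] at this
    rw [this]
    congr 1
    field_simp
    ring
  rw [this]
  refine mem_slOrbit_of_det_eq_one A.2 ?_ ?_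
  · rw [Matrix.det_smul, B.2, Fintype.card_fin, mul_one, ← pow_mul, mul_comm, hx]
  · rw [Matrix.det_smul, C.2, Fintype.card_fin, mul_one, inv_pow, ← pow_mul, hx, inv_one]

theorem isClosed_slOrbit_polyMul {n : ℕ} (hn : n ≠ 0) (h : 2 + n = n + 1 + 1) :
    IsClosed (slOrbit (polyMul 2 n (n + 1) h)) := by
  set P := polyMul 2 n (n + 1) h
  have hP : minorDet (affinePoints n) P ≠ 0 := minorDet_polyMul_ne_zero h
  have : slOrbit P = {T | minorDet (affinePoints n) T = minorDet (affinePoints n) P} := by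
    refine Set.Subset.antisymm (fun T hT => minorDet_eq_of_mem_slOrbit _ hT) fun T hT => ?_
    have hT : minorDet (affinePoints n) T = minorDet (affinePoints n) P := hT
    have hGL : T ∈ glOrbit P := (slSemistable_iff_mem_glOrbit_polyMul hn h T).1
      (slSemistable_of_minorDet_ne_zero hn (hT.trans_ne hP))
    obtain ⟨x, -, S, hS, rfl⟩ := exists_smul_of_mem_glOrbit two_ne_zero hn n.succ_ne_zero hGL
    refine smul_mem_slOrbit hS ?_
    rw [minorDet_smul, minorDet_eq_of_mem_slOrbit _ hS] at hT
    -- Equal nonzero values of a form of degree `n (n + 1)` force the scalar `x` to be a root of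
    -- unity of that order.
    exact mul_right_cancel₀ hP (hT.trans (one_mul _).symm)
  rw [this]
  exact isClosed_eq (continuous_minorDet _) continuous_const

end Tensor3

theorem corollary3p6 (c : ℕ) (hc : 2 ≤ c) :
    {T : Tensor3 2 (c - 1) c | Tensor3.SLSemistable T} = Tensor3.glOrbit (Tensor3.pencil c hc) ∧
      Dense (Tensor3.glOrbit (Tensor3.pencil c hc)) ∧
      IsClosed (Tensor3.slOrbit (Tensor3.pencil c hc)) := by
  obtain ⟨n, rfl⟩ : ∃ n, c = n + 1 := ⟨c - 1, by omega⟩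
  have hn : n ≠ 0 := by omega
  have h : 2 + n = n + 1 + 1 := by omega
  exact ⟨Set.ext fun T => Tensor3.slSemistable_iff_mem_glOrbit_polyMul hn h T,
    Tensor3.dense_glOrbit_polyMul hn h, Tensor3.isClosed_slOrbit_polyMul hn h⟩
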